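/- Let $f_1,f_2:[0,1]\to[0,1]$ be $C^2$ diffeomorphisms with $f_i(0)=0$ and $f_i(1)=1$ for $i=1,2$, and with $f_1(x)<x<f_2(x)$ for all $x\in(0,1)$. Let $p_1,p_2>0$ with $p_1+p_2=1$. Let $\Sigma_2^+=\{1,2\}^{\mathbb N_0}$ and $\Sigma_2=\{1,2\}^{\mathbb Z}$, with the product topologies, the left shift $\sigma$, and the Bernoulli measures $\nu^+$ and $\nu$ giving the symbols $1,2$ the probabilities $p_1,p_2$. Let $$F^+:\Sigma_2^+\times[0,1]\to\Sigma_2^+\times[0,1],\qquad F^+(\omega,x)=(\sigma\omega,f_{\omega_0}(x)),$$ let $F$ be its natural extension, given by the same formula on $\Sigma_2\times[0,1]$, and write $f^n_\omega=f_{\omega_{n-1}}\circ\cdots\circ f_{\omega_0}$. For $x\in\{0,1\}$ let $$L(x)=p_1\ln f_1'(x)+p_2\ln f_2'(x),$$ which is the fiber Lyapunov exponent $\lim_{n\to\infty}\frac1n\sum_{i=0}^{n-1}\ln f_{\omega_i}'(f^i_\omega(x))$ for $\nu^+$-almost every $\omega$. The standard measure on $\Sigma_2^+\times[0,1]$ is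 the product of $\nu^+$ and Lebesgue measure. The basin of a set $A\subset\Sigma_2^+\times[0,1]$ is the set of points whose forward orbit under $F^+$ converges to $A$ (eventually remains in each neighbourhood of $A$). **Theorem.** Assume $L(0)<0$ and $L(1)<0$. Then: 1. the basins of $\Sigma_2^+\times\{0\}$ and of $\Sigma_2^+\times\{1\}$ both have positive standard measure; 2. both basins are dense in $\Sigma_2^+\times[0,1]$; 3. the complement of the union of the two basins has standard measure zero; 4. there is a measurable function $\xi:\Sigma_2\to[0,1]$ whose graph is invariant, $F(\operatorname{graph}\xi)=\operatorname{graph}\xi$, such that for $\nu$-almost every $\omega\in\Sigma_2$ and every $x\in[0,1]$, $$\lim_{n\to\infty}f^n_\omega(x)=\begin{cases}0,&\text{if }x<\xi(\omega),\\ 1,&\text{if }x>\xi(\omega).\end{cases}$$ -/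

import Mathlib

namespace IntermingledBasins

open MeasureTheory Filter Topology

/-- A `C²` diffeomorphism of the unit interval: a bijection of `[0,1]` that is twice continuously
differentiable, together with its inverse, up to the end points.  (`Set.IccExtend` only serves to
regard a function on `[0,1]` as a function on `ℝ`; smoothness is tested on `[0,1]` alone.) -/
structure IntervalDiffeo where
  toEquiv : unitInterval ≃ unitInterval
  contDiffOn : ContDiffOn ℝ 2
    (Set.IccExtend zero_le_one (fun x : unitInterval => ((toEquiv x : unitInterval) : ℝ)))
    unitInterval
  contDiffOn_symm : ContDiffOn ℝ 2
    (Set.IccExtend zero_le_one (fun x : unitInterval => ((toEquiv.symm x : unitInterval) : ℝ)))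
    unitInterval

/-- The derivative `f'(x)` at `x ∈ [0,1]` (one-sided at the end points). -/
noncomputable def IntervalDiffeo.derivative (f : IntervalDiffeo) (x : unitInterval) : ℝ :=
  derivWithin
    (Set.IccExtend zero_le_one (fun y : unitInterval => ((f.toEquiv y : unitInterval) : ℝ)))
    unitInterval x

/-- The class of step skew product systems over the shift on two symbols, given by the two fiber
diffeomorphisms.  The symbols `1, 2` are the elements `0, 1` of `Fin 2`: `f 0` moves the points of
`(0,1)` to the left, and `f 1` moves them to the right. -/
structure ClassS where
  f : Fin 2 → IntervalDiffeo
  map_zero : ∀ i, (f i).toEquiv 0 = 0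
  map_one : ∀ i, (f i).toEquiv 1 = 1
  lt_self : ∀ x : unitInterval, 0 < x → x < 1 → (f 0).toEquiv x < x
  self_lt : ∀ x : unitInterval, 0 < x → x < 1 → x < (f 1).toEquiv x

/-- The left shift on symbol sequences indexed by `ι`; one-sided for `ι = ℕ`, two-sided for
`ι = ℤ`. -/
def shift {ι : Type} [AddMonoidWithOne ι] (ω : ι → Fin 2) : ι → Fin 2 := fun n => ω (n + 1)

/-- The step skew product `(ω, x) ↦ (σ ω, f_{ω₀}(x))`.  For `ι = ℕ` this is the system over
one-sided sequences, and for `ι = ℤ` it is its natural extension. -/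
def ClassS.skew (S : ClassS) (ι : Type) [AddMonoidWithOne ι] (z : (ι → Fin 2) × unitInterval) :
    (ι → Fin 2) × unitInterval :=
  (shift z.1, (S.f (z.1 0)).toEquiv z.2)

/-- The fiber iterate `fⁿ_ω(x)`, the second component of the `n`-th iterate of `(ω, x)`. -/
def ClassS.fiberIter (S : ClassS) {ι : Type} [AddMonoidWithOne ι] (n : ℕ) (ω : ι → Fin 2)
    (x : unitInterval) : unitInterval :=
  ((S.skew ι)^[n] (ω, x)).2

/-- The Bernoulli measure on sequences of symbols (`ν⁺` for `ι = ℕ` and `ν` for `ι = ℤ`). -/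
noncomputable def bernoulli (p : PMF (Fin 2)) (ι : Type) : Measure (ι → Fin 2) :=
  Measure.infinitePi (fun _ : ι => p.toMeasure)

/-- The standard measure on `Σ₂⁺ × [0,1]`: Bernoulli measure times Lebesgue measure. -/
noncomputable def standardMeasure (p : PMF (Fin 2)) : Measure ((ℕ → Fin 2) × unitInterval) :=
  (bernoulli p ℕ).prod volume

/-- The basin of a set `A`: the points whose forward orbit converges to `A`, that is, eventually
enters and remains in every neighbourhood of `A`. -/
def basin {X : Type} [TopologicalSpace X] (F : X → X) (A : Set X) : Set X :=
  {z | Tendsto (fun n : ℕ => F^[n] z) atTop (𝓝ˢ A)}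

/-- The number `ℓ` is the fiber Lyapunov exponent at the point `(ω, x)`. -/
def ClassS.HasLyapunovExponent (S : ClassS) (ω : ℕ → Fin 2) (x : unitInterval) (l : ℝ) : Prop :=
  Tendsto (fun n : ℕ =>
    (∑ i ∈ Finset.range n, Real.log ((S.f (ω i)).derivative (S.fiberIter i ω x))) / (n : ℝ))
    atTop (𝓝 l)

/-- The fiber Lyapunov exponent `L(x) = p₁ ln f₁'(x) + p₂ ln f₂'(x)` at an end point
`x ∈ {0, 1}`. -/
noncomputable def ClassS.L (S : ClassS) (p : PMF (Fin 2)) (x : unitInterval) : ℝ :=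
  ∑ i, (p i).toReal * Real.log ((S.f i).derivative x)

theorem ClassS.fiberIter_fixed (S : ClassS) (x : unitInterval) (hx : x = 0 ∨ x = 1) (n : ℕ)
    (ω : ℕ → Fin 2) : S.fiberIter n ω x = x := by
  have key : ∀ z : (ℕ → Fin 2) × unitInterval, z.2 = x → (S.skew ℕ z).2 = x := by
    rintro ⟨a, y⟩ h
    obtain rfl : y = x := h
    rcases hx with rfl | rfl
    · exact S.map_zero _
    · exact S.map_one _
  have : ∀ n : ℕ, ((S.skew ℕ)^[n] (ω, x)).2 = x := by
    intro n
    induction n with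
    | zero => rfl
    | succ n ih => rw [Function.iterate_succ_apply']; exact key _ ih
  exact this n

/-- At the end points, `L(x)` is the Lyapunov exponent along almost every orbit. -/
theorem ClassS.ae_hasLyapunovExponent (S : ClassS) (p : PMF (Fin 2)) (x : unitInterval)
    (hx : x = 0 ∨ x = 1) :
    ∀ᵐ ω ∂(bernoulli p ℕ), S.HasLyapunovExponent ω x (S.L p x) := by
  let g : Fin 2 → ℝ := fun i => Real.log ((S.f i).derivative x)
  have hg : Measurable g := measurable_of_finite g
  have hmp : ∀ i : ℕ, MeasurePreserving (fun ω : ℕ → Fin 2 => ω i) (bernoulli p ℕ) p.toMeasure :=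
    fun i => measurePreserving_eval_infinitePi (fun _ : ℕ => p.toMeasure) i
  have hint : Integrable g p.toMeasure := Integrable.of_finite
  have hX0 : Integrable (fun ω : ℕ → Fin 2 => g (ω 0)) (bernoulli p ℕ) :=
    (hmp 0).integrable_comp_of_integrable hint
  have hind := ProbabilityTheory.iIndepFun_infinitePi (P := fun _ : ℕ => p.toMeasure)
    (X := fun _ : ℕ => g) (fun _ => hg)
  have h := ProbabilityTheory.strong_law_ae_real (μ := bernoulli p ℕ)
    (fun (i : ℕ) (ω : ℕ → Fin 2) => g (ω i)) hX0
    (fun i j hij => hind.indepFun hij)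
    (fun i => ⟨(hg.comp (hmp i).measurable).aemeasurable,
      (hg.comp (hmp 0).measurable).aemeasurable, by
        have e : ∀ j : ℕ, Measure.map (fun ω : ℕ → Fin 2 => g (ω j)) (bernoulli p ℕ)
            = Measure.map g p.toMeasure := fun j => by
          rw [← (hmp j).map_eq, Measure.map_map hg (hmp j).measurable]; rfl
        rw [e i, e 0]⟩)
  have hval : ∫ ω, g (ω 0) ∂(bernoulli p ℕ) = S.L p x := by
    have e1 : ∫ ω, g (ω 0) ∂(bernoulli p ℕ) = ∫ i, g i ∂p.toMeasure := by
      rw [← (hmp 0).map_eq, integral_map (hmp 0).measurable.aemeasurable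
        hg.aestronglyMeasurable]
    rw [e1, PMF.integral_eq_sum]
    rfl
  filter_upwards [h] with ω hω
  rw [hval] at hω
  unfold ClassS.HasLyapunovExponent
  simp only [S.fiberIter_fixed x hx]
  exact hω

end IntermingledBasins

/-!
The fiber maps are increasing homeomorphisms, so in every fiber the points attracted to `0` form an
initial segment and those attracted to `1` a final segment.  Everything follows once almost every
orbit is known to converge to one of the end points.

Near an end point `e` a fiber map changes the distance to `e` by a factor of at most
`exp (log f'(e) + ε)`.  By the law of large numbers the logarithms of these factors have a negative
average along almost every sequence, so `e` attracts a neighbourhood in almost every fiber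
(`ClassS.ae_eventually_tendsto`).  In particular the probability that the orbit of `x` converges to
`e` tends to `1` as `x → e`, and by Fubini's theorem the basins have positive measure.  They are
dense since a sequence may be continued, from an arbitrarily late position on, by a constant symbol
whose fiber map pushes the whole open interval to the desired end point (`ClassS.dense_basin`).

The probability `g x` that the orbit of `x` converges to neither end point is harmonic for the
random walk generated by the fiber maps, and it tends to `0` at both end points.  As finitely many
applications of `f 0`, in a number that can be chosen uniformly away from `1`, lead close to `0`,
a kind of maximum principle yields `g = 0` (`ClassS.undecided_real_eq_zero`).

The graph is that of `ξ ω = sup {x | fⁿ_ω x → 0}`.  The defining set is carried by the fiber map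
onto the one over the shifted sequence, whence the invariance over every `ω`; and applying `g = 0`
to a countable dense set of points shows that almost surely all points above `ξ ω` tend to `1`.
-/

namespace IntermingledBasins

open MeasureTheory Filter Topology

/-! ### The fiber maps -/

theorem IntervalDiffeo.continuous (f : IntervalDiffeo) : Continuous f.toEquiv := by
  have h := continuousOn_iff_continuous_domRestrict.1 f.contDiffOn.continuousOn
  rw [continuous_induced_rng]
  convert h using 1
  ext x
  simp [Set.IccExtend_of_mem _ _ x.2]

/-- Near a fixed point `e`, distances to `e` grow at most by a factor slightly larger than
`exp (log f'(e))`.  This needs no sign condition on `f'(e)`, as `|d| ≤ exp (log d)` for every real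
`d` (also for `d = 0`, where `Real.log 0 = 0`). -/
theorem IntervalDiffeo.eventually_dist_le (f : IntervalDiffeo) {e : unitInterval}
    (he : f.toEquiv e = e) {ε : ℝ} (hε : 0 < ε) :
    ∀ᶠ x in 𝓝 e, dist (f.toEquiv x) e ≤ Real.exp (Real.log (f.derivative e) + ε) * dist x e := by
  have hd := ((f.contDiffOn.differentiableOn (by norm_num)) e e.2).hasDerivWithinAt
  change HasDerivWithinAt _ (f.derivative e) _ _ at hd
  have hd' : |f.derivative e| < Real.exp (Real.log (f.derivative e) + ε) := by
    rcases eq_or_ne (f.derivative e) 0 with h | h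
    · rw [h, abs_zero]; exact Real.exp_pos _
    · rw [Real.exp_add, Real.exp_log_eq_abs h]
      exact lt_mul_of_one_lt_right (abs_pos.2 h) (Real.one_lt_exp_iff.2 hε)
  have ho := hd.isLittleO.def (sub_pos.2 hd')
  rw [nhdsWithin_eq_map_subtype_coe e.2, eventually_map] at ho
  filter_upwards [ho] with x hx
  simp only [Set.IccExtend_val, he, Real.norm_eq_abs, smul_eq_mul] at hx
  rw [Subtype.dist_eq, Subtype.dist_eq, Real.dist_eq, Real.dist_eq]
  calc |((f.toEquiv x : unitInterval) : ℝ) - e|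
      = |(((f.toEquiv x : unitInterval) : ℝ) - e - (x - e) * f.derivative e)
          + (x - e) * f.derivative e| := by ring_nf
    _ ≤ _ := abs_add_le _ _
    _ ≤ (Real.exp (Real.log (f.derivative e) + ε) - |f.derivative e|) * |(x : ℝ) - e|
          + |(x : ℝ) - e| * |f.derivative e| := by
        rw [abs_mul]; exact add_le_add_left hx _
    _ = _ := by ring

theorem ClassS.map_endpoint (S : ClassS) {e : unitInterval} (he : e = 0 ∨ e = 1) (i : Fin 2) :
    (S.f i).toEquiv e = e := by
  rcases he with rfl | rfl
  · exact S.map_zero i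
  · exact S.map_one i

theorem ClassS.strictMono (S : ClassS) (i : Fin 2) : StrictMono (S.f i).toEquiv :=
  (S.f i).continuous.strictMono_of_inj_boundedOrder
    (by
      rw [show (⊥ : unitInterval) = 0 from rfl, S.map_zero i]
      exact bot_le)
    (S.f i).toEquiv.injective

theorem ClassS.tendsto_iterate_zero (S : ClassS) {x : unitInterval} (hx : x ≠ 1) :
    Tendsto (fun n : ℕ => (S.f 0).toEquiv^[n] x) atTop (𝓝 0) := by
  have hx1 : x < 1 := lt_of_le_of_ne x.2.2 hx
  have hle : (S.f 0).toEquiv x ≤ x := by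
    rcases eq_or_ne x 0 with rfl | h0
    · exact (S.map_zero 0).le
    · exact (S.lt_self x (unitInterval.pos_iff_ne_zero.2 h0) hx1).le
  have hanti := (S.strictMono 0).monotone.antitone_iterate_of_map_le hle
  have hlim := tendsto_atTop_iInf hanti
  have hfix := isFixedPt_of_tendsto_iterate hlim (S.f 0).continuous.continuousAt
  have hl1 : (⨅ n : ℕ, (S.f 0).toEquiv^[n] x) < 1 := (iInf_le _ 0).trans_lt hx1
  have h0 : (⨅ n : ℕ, (S.f 0).toEquiv^[n] x) = 0 := by
    by_contra h
    exact (S.lt_self _ (unitInterval.pos_iff_ne_zero.2 h) hl1).ne hfix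
  rwa [h0] at hlim

theorem ClassS.tendsto_iterate_one (S : ClassS) {x : unitInterval} (hx : x ≠ 0) :
    Tendsto (fun n : ℕ => (S.f 1).toEquiv^[n] x) atTop (𝓝 1) := by
  have hx0 : 0 < x := unitInterval.pos_iff_ne_zero.2 hx
  have hle : x ≤ (S.f 1).toEquiv x := by
    rcases eq_or_ne x 1 with rfl | h1
    · exact (S.map_one 1).ge
    · exact (S.self_lt x hx0 (lt_of_le_of_ne x.2.2 h1)).le
  have hmono := (S.strictMono 1).monotone.monotone_iterate_of_le_map hle
  have hlim := tendsto_atTop_iSup hmono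
  have hfix := isFixedPt_of_tendsto_iterate hlim (S.f 1).continuous.continuousAt
  have hl0 : 0 < (⨆ n : ℕ, (S.f 1).toEquiv^[n] x) :=
    hx0.trans_le (le_iSup (fun n : ℕ => (S.f 1).toEquiv^[n] x) 0)
  have h1 : (⨆ n : ℕ, (S.f 1).toEquiv^[n] x) = 1 := by
    by_contra h
    exact (S.self_lt _ hl0 (lt_of_le_of_ne unitInterval.le_one' h)).ne' hfix
  rwa [h1] at hlim

/-! ### Fiber iterates -/

section Iterates

variable {ι : Type} [AddMonoidWithOne ι] (S : ClassS)

theorem ClassS.fiberIter_succ (n : ℕ) (ω : ι → Fin 2) (x : unitInterval) :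
    S.fiberIter (n + 1) ω x = S.fiberIter n (shift ω) ((S.f (ω 0)).toEquiv x) := rfl

theorem ClassS.fiberIter_strictMono (n : ℕ) (ω : ι → Fin 2) : StrictMono (S.fiberIter n ω) := by
  induction n generalizing ω with
  | zero => exact strictMono_id
  | succ n ih => exact (ih (shift ω)).comp (S.strictMono (ω 0))

theorem ClassS.fiberIter_endpoint {e : unitInterval} (he : e = 0 ∨ e = 1) (n : ℕ)
    (ω : ι → Fin 2) : S.fiberIter n ω e = e := by
  induction n generalizing ω with
  | zero => rfl
  | succ n ih => rw [S.fiberIter_succ, S.map_endpoint he, ih]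

theorem fst_iterate_skew (n : ℕ) (z : (ι → Fin 2) × unitInterval) :
    ((S.skew ι)^[n] z).1 = shift^[n] z.1 := by
  induction n generalizing z with
  | zero => rfl
  | succ n ih => rw [Function.iterate_succ_apply, ih, Function.iterate_succ_apply]; rfl

theorem shift_iterate_apply (n k : ℕ) (ω : ℕ → Fin 2) : shift^[n] ω k = ω (k + n) := by
  induction n generalizing ω with
  | zero => rfl
  | succ n ih =>
    rw [Function.iterate_succ_apply, ih]
    rfl

theorem ClassS.fiberIter_add (k n : ℕ) (ω : ι → Fin 2) (x : unitInterval) :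
    S.fiberIter (k + n) ω x = S.fiberIter k (shift^[n] ω) (S.fiberIter n ω x) := by
  unfold ClassS.fiberIter
  rw [Function.iterate_add_apply, ← fst_iterate_skew S n (ω, x)]

theorem ClassS.fiberIter_succ' (n : ℕ) (ω : ℕ → Fin 2) (x : unitInterval) :
    S.fiberIter (n + 1) ω x = (S.f (ω n)).toEquiv (S.fiberIter n ω x) := by
  rw [add_comm, S.fiberIter_add 1 n, S.fiberIter_succ, shift_iterate_apply, zero_add]
  rfl

theorem ClassS.fiberIter_const (i : Fin 2) (n : ℕ) (x : unitInterval) :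
    S.fiberIter n (fun _ : ℕ => i) x = (S.f i).toEquiv^[n] x := by
  induction n with
  | zero => rfl
  | succ n ih => rw [S.fiberIter_succ', ih, Function.iterate_succ_apply']

/-- The fiber iterates over a two-sided sequence depend on its nonnegative part only. -/
theorem ClassS.fiberIter_int (n : ℕ) (ω : ℤ → Fin 2) (x : unitInterval) :
    S.fiberIter n ω x = S.fiberIter n (fun k : ℕ => ω k) x := by
  induction n generalizing ω x with
  | zero => rfl
  | succ n ih =>
    rw [S.fiberIter_succ, S.fiberIter_succ, ih]
    rfl

theorem ClassS.tendsto_fiberIter_shift (ω : ι → Fin 2) (x e : unitInterval) :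
    Tendsto (fun n => S.fiberIter n (shift ω) ((S.f (ω 0)).toEquiv x)) atTop (𝓝 e) ↔
      Tendsto (fun n => S.fiberIter n ω x) atTop (𝓝 e) :=
  tendsto_add_atTop_iff_nat (f := fun n => S.fiberIter n ω x) 1

theorem ClassS.tendsto_zero_of_le {ω : ι → Fin 2} {x y : unitInterval} (hxy : x ≤ y)
    (hy : Tendsto (fun n => S.fiberIter n ω y) atTop (𝓝 0)) :
    Tendsto (fun n => S.fiberIter n ω x) atTop (𝓝 0) :=
  tendsto_of_tendsto_of_tendsto_of_le_of_le tendsto_const_nhds hy (fun _ => bot_le)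
    fun n => (S.fiberIter_strictMono n ω).monotone hxy

theorem ClassS.tendsto_one_of_le {ω : ι → Fin 2} {x y : unitInterval} (hxy : x ≤ y)
    (hx : Tendsto (fun n => S.fiberIter n ω x) atTop (𝓝 1)) :
    Tendsto (fun n => S.fiberIter n ω y) atTop (𝓝 1) :=
  tendsto_of_tendsto_of_tendsto_of_le_of_le hx tendsto_const_nhds
    (fun n => (S.fiberIter_strictMono n ω).monotone hxy) fun _ => le_top

theorem ClassS.measurable_skew : Measurable (S.skew ι) := by
  unfold ClassS.skew shift
  refine Measurable.prodMk (by fun_prop) ?_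
  have h : (fun z : (ι → Fin 2) × unitInterval => (S.f (z.1 0)).toEquiv z.2) =
      fun z => if z.1 0 = 0 then (S.f 0).toEquiv z.2 else (S.f 1).toEquiv z.2 := by
    ext z
    split_ifs with h0
    · rw [h0]
    · rw [Fin.eq_one_of_ne_zero _ h0]
  rw [h]
  refine Measurable.ite ?_ ((S.f 0).continuous.measurable.comp measurable_snd)
    ((S.f 1).continuous.measurable.comp measurable_snd)
  exact ((measurable_pi_apply 0).comp measurable_fst) (measurableSet_singleton 0)

theorem ClassS.measurable_fiberIter (n : ℕ) :
    Measurable fun z : (ι → Fin 2) × unitInterval => S.fiberIter n z.1 z.2 :=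
  measurable_snd.comp (S.measurable_skew.iterate n)

theorem ClassS.measurableSet_tendsto_prod (e : unitInterval) :
    MeasurableSet {z : (ι → Fin 2) × unitInterval |
      Tendsto (fun n => S.fiberIter n z.1 z.2) atTop (𝓝 e)} :=
  measurableSet_tendsto (𝓝 e) fun n => S.measurable_fiberIter n

theorem ClassS.measurableSet_tendsto_fiber (e x : unitInterval) :
    MeasurableSet {ω : ι → Fin 2 | Tendsto (fun n => S.fiberIter n ω x) atTop (𝓝 e)} :=
  (S.measurableSet_tendsto_prod e).preimage (measurable_id.prodMk measurable_const)

end Iterates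

/-! ### Basins -/

theorem ClassS.basin_eq (S : ClassS) (e : unitInterval) :
    basin (S.skew ℕ) (Set.univ ×ˢ {e}) =
      {z | Tendsto (fun n => S.fiberIter n z.1 z.2) atTop (𝓝 e)} := by
  ext z
  change Tendsto _ _ _ ↔ Tendsto _ _ _
  rw [isCompact_univ.nhdsSet_prod_eq isCompact_singleton, nhdsSet_univ, nhdsSet_singleton,
    Filter.top_prod, tendsto_comap_iff]
  rfl

/-- If the iterates of one fiber map `f i` attract all points but `e'` to `e`, then the basin of
`e` is dense: the symbols of any sequence may be replaced by `i` from some late position on. -/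
theorem ClassS.dense_basin (S : ClassS) {e e' : unitInterval} (he' : e' = 0 ∨ e' = 1) (i : Fin 2)
    (h : ∀ x ≠ e', Tendsto (fun n : ℕ => (S.f i).toEquiv^[n] x) atTop (𝓝 e)) :
    Dense (basin (S.skew ℕ) (Set.univ ×ˢ {e})) := by
  have hd : Dense ((Set.univ : Set (ℕ → Fin 2)) ×ˢ ({e'}ᶜ : Set unitInterval)) :=
    dense_univ.prod (dense_compl_singleton e')
  refine dense_closure.1 (hd.mono ?_)
  rintro ⟨ω, x⟩ ⟨-, hx⟩
  let w : ℕ → ℕ → Fin 2 := fun n k => if k < n then ω k else i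
  have hw : Tendsto (fun n => (w n, x)) atTop (𝓝 (ω, x)) := by
    refine Tendsto.prodMk_nhds (tendsto_pi_nhds.2 fun k => ?_) tendsto_const_nhds
    refine tendsto_const_nhds.congr' ?_
    filter_upwards [eventually_gt_atTop k] with n hn
    simp [w, hn]
  refine mem_closure_of_tendsto hw (Eventually.of_forall fun n => ?_)
  rw [S.basin_eq]
  refine (tendsto_add_atTop_iff_nat n).1 ?_
  have hs : shift^[n] (w n) = fun _ => i := by
    ext k
    simp [shift_iterate_apply, w]
  simp only [S.fiberIter_add, hs, S.fiberIter_const]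
  refine h _ fun h' => hx ?_
  rw [← S.fiberIter_endpoint he' n (w n)] at h'
  exact (S.fiberIter_strictMono n (w n)).injective h'

/-! ### The Bernoulli measure -/

instance (p : PMF (Fin 2)) (ι : Type) : IsProbabilityMeasure (bernoulli p ι) := by
  unfold bernoulli; infer_instance

/-- The sequence with zeroth symbol `i` whose shift is `ω`. -/
def cons (i : Fin 2) (ω : ℕ → Fin 2) : ℕ → Fin 2
  | 0 => i
  | n + 1 => ω n

theorem measurable_cons : Measurable fun q : Fin 2 × (ℕ → Fin 2) => cons q.1 q.2 := by
  refine measurable_pi_iff.2 fun n => ?_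
  cases n with
  | zero => exact measurable_fst
  | succ n => exact (measurable_pi_apply n).comp measurable_snd

/-- Under the Bernoulli measure the zeroth symbol is independent of the shifted sequence, which
is again Bernoulli distributed. -/
theorem bernoulli_map_cons (p : PMF (Fin 2)) :
    (p.toMeasure.prod (bernoulli p ℕ)).map (fun q => cons q.1 q.2) = bernoulli p ℕ := by
  refine Measure.eq_infinitePi _ fun s t ht => ?_
  rw [Measure.map_apply measurable_cons (MeasurableSet.pi s.countable_toSet fun i _ => ht i)]
  have key : (fun q : Fin 2 × (ℕ → Fin 2) => cons q.1 q.2) ⁻¹' (s : Set ℕ).pi t =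
      (if 0 ∈ s then t 0 else Set.univ) ×ˢ
        ((s.preimage Nat.succ Nat.succ_injective.injOn : Finset ℕ) : Set ℕ).pi
          fun n => t (n + 1) := by
    ext ⟨i, ω⟩
    simp only [Set.mem_preimage, Set.mem_pi, Set.mem_prod, Finset.coe_preimage, Finset.mem_coe]
    constructor
    · intro h
      refine ⟨?_, fun n hn => h (n + 1) hn⟩
      split_ifs with h0
      · exact h 0 h0
      · trivial
    · rintro ⟨h0, h⟩ n hn
      cases n with
      | zero => rwa [if_pos hn] at h0
      | succ n => exact h n hn
  rw [key, Measure.prod_prod, bernoulli, Measure.infinitePi_pi _ fun i _ => ht _]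
  have hs : ∏ i ∈ s, p.toMeasure (t i) = (if 0 ∈ s then p.toMeasure (t 0) else 1) *
      ∏ i ∈ s.filter (· ≠ 0), p.toMeasure (t i) := by
    rw [← Finset.prod_filter_mul_prod_filter_not s (· = 0)]
    congr 1
    rw [Finset.filter_eq' s 0]
    split_ifs <;> simp
  rw [hs]
  congr 1
  · split_ifs <;> simp
  · refine Finset.prod_bij (fun n _ => n + 1) ?_ ?_ ?_ ?_
    · intro n hn; simpa using hn
    · intro a _ b _ h; exact Nat.succ_injective h
    · intro b hb
      rw [Finset.mem_filter] at hb
      obtain ⟨n, rfl⟩ := Nat.exists_eq_succ_of_ne_zero hb.2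
      exact ⟨n, by simpa using hb.1, rfl⟩
    · intro n _; rfl

theorem bernoulli_real_eq_sum_cons (p : PMF (Fin 2)) {E : Set (ℕ → Fin 2)}
    (hE : MeasurableSet E) :
    (bernoulli p ℕ).real E =
      ∑ i, (p i).toReal * (bernoulli p ℕ).real {ω | cons i ω ∈ E} := by
  have hm := hE.preimage measurable_cons
  have h : bernoulli p ℕ E = ∑ i, p i * bernoulli p ℕ {ω | cons i ω ∈ E} := by
    conv_lhs => rw [← bernoulli_map_cons p]
    rw [Measure.map_apply measurable_cons hE, Measure.prod_apply hm, lintegral_fintype]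
    refine Finset.sum_congr rfl fun i _ => ?_
    rw [PMF.toMeasure_apply_singleton _ _ (measurableSet_singleton i), mul_comm]
    rfl
  rw [Measure.real, h, ENNReal.toReal_sum fun i _ =>
    ENNReal.mul_ne_top (p.apply_ne_top i) (measure_ne_top _ _)]
  simp only [ENNReal.toReal_mul, Measure.real]

theorem sum_toReal_eq_one (p : PMF (Fin 2)) : (p 0).toReal + (p 1).toReal = 1 := by
  have h := p.tsum_coe
  rw [tsum_fintype, Fin.sum_univ_two] at h
  rw [← ENNReal.toReal_add (p.apply_ne_top 0) (p.apply_ne_top 1), h, ENNReal.toReal_one]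

/-- The nonnegative part of a two-sided Bernoulli sequence is a one-sided Bernoulli sequence. -/
theorem measurePreserving_bernoulli_int (p : PMF (Fin 2)) :
    MeasurePreserving (fun (ω : ℤ → Fin 2) (k : ℕ) => ω k) (bernoulli p ℤ) (bernoulli p ℕ) := by
  have hm : Measurable (fun (ω : ℤ → Fin 2) (k : ℕ) => ω k) := by fun_prop
  refine ⟨hm, Measure.eq_infinitePi _ fun s t ht => ?_⟩
  rw [Measure.map_apply hm (MeasurableSet.pi s.countable_toSet fun i _ => ht i)]
  have key : (fun (ω : ℤ → Fin 2) (k : ℕ) => ω k) ⁻¹' (s : Set ℕ).pi t =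
      ((s.map Nat.castEmbedding : Finset ℤ) : Set ℤ).pi fun k => t k.toNat := by
    ext ω
    simp [Set.mem_pi]
  rw [key, bernoulli, Measure.infinitePi_pi _ fun i _ => ht _, Finset.prod_map]
  simp

/-! ### Attraction near the end points -/

/-- A nonnegative sequence which, as long as it stays below `δ`, is multiplied at each step by at
most `exp (c n)`, converges to `0` if it starts close enough to `0` and the averages of `c` have a
negative limit: the partial sums of `c` are then bounded above and tend to `-∞`. -/
theorem exists_tendsto_zero_of_average_neg {c : ℕ → ℝ} {l δ : ℝ} (hl : l < 0) (hδ : 0 < δ)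
    (hc : Tendsto (fun n : ℕ => (∑ i ∈ Finset.range n, c i) / (n : ℝ)) atTop (𝓝 l)) :
    ∃ r > 0, ∀ a : ℕ → ℝ, (∀ n, 0 ≤ a n) →
      (∀ n, a n ≤ δ → a (n + 1) ≤ Real.exp (c n) * a n) → a 0 ≤ r →
      Tendsto a atTop (𝓝 0) := by
  set s : ℕ → ℝ := fun n => ∑ i ∈ Finset.range n, c i with hs
  have hsbot : Tendsto s atTop atBot := by
    have h := Tendsto.neg_mul_atTop hl hc tendsto_natCast_atTop_atTop
    refine h.congr' ?_
    filter_upwards [eventually_gt_atTop 0] with n hn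
    have : (n : ℝ) ≠ 0 := by positivity
    field_simp
    rfl
  obtain ⟨C, hC⟩ : BddAbove (Set.range s) :=
    (isBoundedUnder_of_eventually_le (hsbot.eventually (eventually_le_atBot 0))).bddAbove_range
  refine ⟨δ * Real.exp (-C), by positivity, fun a ha hstep h0 => ?_⟩
  have hbound : ∀ n, a n ≤ Real.exp (s n) * a 0 := by
    intro n
    induction n with
    | zero => simp [hs]
    | succ n ih =>
      have hsmall : a n ≤ δ := calc
        a n ≤ Real.exp C * (δ * Real.exp (-C)) :=
          ih.trans (mul_le_mul (Real.exp_le_exp.2 (hC ⟨n, rfl⟩)) h0 (ha 0) (Real.exp_pos _).le)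
        _ = δ := by rw [Real.exp_neg]; field_simp
      calc a (n + 1) ≤ Real.exp (c n) * a n := hstep n hsmall
        _ ≤ Real.exp (c n) * (Real.exp (s n) * a 0) := by gcongr
        _ = Real.exp (s (n + 1)) * a 0 := by
          rw [← mul_assoc, ← Real.exp_add, hs]
          simp only [Finset.sum_range_succ]
          rw [add_comm]
  refine squeeze_zero ha hbound ?_
  simpa using (Real.tendsto_exp_atBot.comp hsbot).mul_const (a 0)

/-- A negative Lyapunov exponent at an end point `e` makes `e` attract a neighbourhood, depending
on `ω`, in almost every fiber. -/
theorem ClassS.ae_eventually_tendsto (S : ClassS) (p : PMF (Fin 2)) {e : unitInterval}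
    (he : e = 0 ∨ e = 1) (hL : S.L p e < 0) :
    ∀ᵐ ω ∂(bernoulli p ℕ), ∀ᶠ x in 𝓝 e, Tendsto (fun n => S.fiberIter n ω x) atTop (𝓝 e) := by
  filter_upwards [S.ae_hasLyapunovExponent p e he] with ω hω
  set ε : ℝ := -S.L p e / 2 with hεdef
  have hε : 0 < ε := by rw [hεdef]; linarith
  obtain ⟨δ, hδ, hball⟩ := Metric.eventually_nhds_iff.1
    (eventually_all.2 fun i => (S.f i).eventually_dist_le (S.map_endpoint he i) hε)
  have hc : Tendsto (fun n : ℕ => (∑ i ∈ Finset.range n,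
      (Real.log ((S.f (ω i)).derivative e) + ε)) / (n : ℝ)) atTop (𝓝 (S.L p e + ε)) := by
    unfold ClassS.HasLyapunovExponent at hω
    simp only [S.fiberIter_fixed e he] at hω
    refine (hω.add_const ε).congr' ?_
    filter_upwards [eventually_gt_atTop 0] with n hn
    have : (n : ℝ) ≠ 0 := by positivity
    rw [Finset.sum_add_distrib, Finset.sum_const, Finset.card_range, nsmul_eq_mul]
    field_simp
  obtain ⟨r, hr, hattr⟩ := exists_tendsto_zero_of_average_neg (δ := δ / 2)
    (by rw [hεdef]; linarith) (by positivity) hc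
  filter_upwards [Metric.closedBall_mem_nhds e hr] with x hx
  rw [tendsto_iff_dist_tendsto_zero]
  refine hattr (fun n => dist (S.fiberIter n ω x) e) (fun _ => dist_nonneg) (fun n hn => ?_) hx
  rw [S.fiberIter_succ']
  exact hball (by linarith) (ω n)

theorem ClassS.tendsto_bernoulli_basin (S : ClassS) (p : PMF (Fin 2)) {e : unitInterval}
    (he : e = 0 ∨ e = 1) (hL : S.L p e < 0) :
    Tendsto (fun x => bernoulli p ℕ {ω | Tendsto (fun n => S.fiberIter n ω x) atTop (𝓝 e)})
      (𝓝 e) (𝓝 1) := by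
  rw [← measure_univ (μ := bernoulli p ℕ)]
  refine tendsto_measure_of_ae_tendsto_indicator_of_isFiniteMeasure _ MeasurableSet.univ
    (fun x => S.measurableSet_tendsto_fiber e x) ?_
  filter_upwards [S.ae_eventually_tendsto p he hL] with ω hω
  filter_upwards [hω] with x hx
  simpa using hx

theorem ClassS.standardMeasure_basin_pos (S : ClassS) (p : PMF (Fin 2)) {e : unitInterval}
    (he : e = 0 ∨ e = 1) (hL : S.L p e < 0) :
    0 < standardMeasure p (basin (S.skew ℕ) (Set.univ ×ˢ {e})) := by
  obtain ⟨U, hU, hUo, heU⟩ := eventually_nhds_iff.1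
    ((S.tendsto_bernoulli_basin p he hL).eventually (lt_mem_nhds one_pos))
  obtain ⟨a, b, hab, hsub⟩ := hUo.exists_Ioo_subset ⟨e, heU⟩
  rw [S.basin_eq, pos_iff_ne_zero, standardMeasure]
  intro h0
  rw [Measure.prod_apply_symm (S.measurableSet_tendsto_prod e),
    lintegral_eq_zero_iff (measurable_measure_prodMk_right (S.measurableSet_tendsto_prod e))] at h0
  have hnull : volume (Set.Ioo a b) = 0 :=
    measure_mono_null (fun x hx => (hU x (hsub hx)).ne') (ae_iff.1 h0)
  rw [unitInterval.volume_Ioo, ENNReal.ofReal_eq_zero] at hnull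
  exact absurd (sub_pos.2 (Subtype.coe_lt_coe.2 hab)) hnull.not_gt

/-! ### Almost every orbit converges to an end point -/

/-- The sequences `ω` for which the orbit of `x` converges to neither end point. -/
def ClassS.undecided (S : ClassS) (x : unitInterval) : Set (ℕ → Fin 2) :=
  {ω | ¬ Tendsto (fun n => S.fiberIter n ω x) atTop (𝓝 0) ∧
    ¬ Tendsto (fun n => S.fiberIter n ω x) atTop (𝓝 1)}

theorem ClassS.measurableSet_undecided (S : ClassS) (x : unitInterval) :
    MeasurableSet (S.undecided x) :=
  (S.measurableSet_tendsto_fiber 0 x).compl.inter (S.measurableSet_tendsto_fiber 1 x).compl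

/-- The probability of being undecided is harmonic for the random walk with steps `f 0`, `f 1`. -/
theorem ClassS.undecided_real_eq (S : ClassS) (p : PMF (Fin 2)) (x : unitInterval) :
    (bernoulli p ℕ).real (S.undecided x) =
      ∑ i, (p i).toReal * (bernoulli p ℕ).real (S.undecided ((S.f i).toEquiv x)) := by
  rw [bernoulli_real_eq_sum_cons p (S.measurableSet_undecided x)]
  refine Finset.sum_congr rfl fun i _ => ?_
  congr 2
  ext ω
  have h : ∀ e, Tendsto (fun n => S.fiberIter n ω ((S.f i).toEquiv x)) atTop (𝓝 e) ↔
      Tendsto (fun n => S.fiberIter n (cons i ω) x) atTop (𝓝 e) :=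
    S.tendsto_fiberIter_shift (cons i ω) x
  simp only [ClassS.undecided, Set.mem_ofPred_eq, h]

theorem ClassS.undecided_real_le (S : ClassS) (p : PMF (Fin 2)) {M : ℝ}
    (hM : ∀ x, (bernoulli p ℕ).real (S.undecided x) ≤ M) (N : ℕ) (x : unitInterval) :
    (bernoulli p ℕ).real (S.undecided x) ≤
      (p 0).toReal ^ N * (bernoulli p ℕ).real (S.undecided ((S.f 0).toEquiv^[N] x)) +
        (1 - (p 0).toReal ^ N) * M := by
  induction N generalizing x with
  | zero => simp
  | succ N ih =>
    rw [S.undecided_real_eq p x, Fin.sum_univ_two, Function.iterate_succ_apply]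
    have h1 := mul_le_mul_of_nonneg_left (ih ((S.f 0).toEquiv x))
      (ENNReal.toReal_nonneg (a := p 0))
    have h2 := mul_le_mul_of_nonneg_left (hM ((S.f 1).toEquiv x))
      (ENNReal.toReal_nonneg (a := p 1))
    have h3 : (p 1).toReal = 1 - (p 0).toReal := by linarith [sum_toReal_eq_one p]
    rw [h3] at h2 ⊢
    calc _ ≤ _ := add_le_add h1 h2
      _ = _ := by ring

theorem ClassS.tendsto_undecided (S : ClassS) (p : PMF (Fin 2)) {e : unitInterval}
    (he : e = 0 ∨ e = 1) (hL : S.L p e < 0) :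
    Tendsto (fun x => (bernoulli p ℕ).real (S.undecided x)) (𝓝 e) (𝓝 0) := by
  have h := tendsto_measure_of_ae_tendsto_indicator_of_isFiniteMeasure (μ := bernoulli p ℕ)
    (𝓝 e) (A := ∅) MeasurableSet.empty (fun x => S.measurableSet_undecided x) (by
      filter_upwards [S.ae_eventually_tendsto p he hL] with ω hω
      filter_upwards [hω] with x hx
      simp only [Set.mem_empty_iff_false, iff_false]
      rintro ⟨h0, h1⟩
      rcases he with rfl | rfl
      · exact h0 hx
      · exact h1 hx)
  simpa [Measure.real, Function.comp_def] using (ENNReal.tendsto_toReal (measure_ne_top _ _)).comp h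

/-- The orbit of every point almost surely converges to an end point.  Let `M` be the supremum over
`x` of the probability `g x` of being undecided and suppose `M > 0`.  Then `g ≤ M / 2` near both
end points.  From everywhere else, `N` successive applications of `f 0`, which have probability
`p₀ ^ N`, lead close to `0`, where `N` does not depend on the point; hence
`g ≤ M - p₀ ^ N * M / 2` everywhere, contradicting the choice of `M`. -/
theorem ClassS.undecided_real_eq_zero (S : ClassS) {p : PMF (Fin 2)} (hp : 0 < p 0)
    (hL0 : S.L p 0 < 0) (hL1 : S.L p 1 < 0) (x : unitInterval) :
    (bernoulli p ℕ).real (S.undecided x) = 0 := by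
  set g : unitInterval → ℝ := fun x => (bernoulli p ℕ).real (S.undecided x) with hg
  have hbdd : BddAbove (Set.range g) := ⟨1, by rintro _ ⟨y, rfl⟩; exact measureReal_le_one⟩
  have hM : ∀ y, g y ≤ ⨆ x, g x := fun y => le_ciSup hbdd y
  set M : ℝ := ⨆ x, g x with hMdef
  refine le_antisymm ((hM x).trans (le_of_not_gt fun hMpos => ?_)) measureReal_nonneg
  have hhalf : (0 : ℝ) < M / 2 := by positivity
  have near0 := (S.tendsto_undecided p (Or.inl rfl) hL0).eventually (gt_mem_nhds hhalf)
  have near1 := (S.tendsto_undecided p (Or.inr rfl) hL1).eventually (gt_mem_nhds hhalf)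
  obtain ⟨a, ha, hga⟩ := exists_Ico_subset_of_mem_nhds near0 ⟨1, zero_lt_one⟩
  obtain ⟨b, hb, hgb⟩ := exists_Ioc_subset_of_mem_nhds near1 ⟨0, zero_lt_one⟩
  obtain ⟨N, hN⟩ := ((S.tendsto_iterate_zero hb.ne).eventually (gt_mem_nhds ha)).exists
  have hp0 : 0 < (p 0).toReal := ENNReal.toReal_pos hp.ne' (p.apply_ne_top 0)
  have hp1 : (p 0).toReal ≤ 1 := by
    linarith [sum_toReal_eq_one p, ENNReal.toReal_nonneg (a := p 1)]
  have hq : 0 < (p 0).toReal ^ N := pow_pos hp0 N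
  have hq1 : (p 0).toReal ^ N ≤ 1 := pow_le_one₀ hp0.le hp1
  have hall : ∀ y, g y ≤ M - (p 0).toReal ^ N * (M / 2) := by
    intro y
    rcases le_or_gt y b with hy | hy
    · have hlt : (S.f 0).toEquiv^[N] y < a :=
        ((S.strictMono 0).monotone.iterate N hy).trans_lt hN
      have h1 : g ((S.f 0).toEquiv^[N] y) < M / 2 := hga ⟨unitInterval.nonneg', hlt⟩
      have h2 : g y ≤ _ := S.undecided_real_le p hM N y
      nlinarith
    · have h1 : g y < M / 2 := hgb ⟨hy, y.2.2⟩
      nlinarith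
  have := ciSup_le hall
  rw [← hMdef] at this
  nlinarith

theorem ClassS.standardMeasure_compl_basins (S : ClassS) {p : PMF (Fin 2)} (hp : 0 < p 0)
    (hL0 : S.L p 0 < 0) (hL1 : S.L p 1 < 0) :
    standardMeasure p
      (basin (S.skew ℕ) (Set.univ ×ˢ {0}) ∪ basin (S.skew ℕ) (Set.univ ×ˢ {1}))ᶜ = 0 := by
  rw [S.basin_eq, S.basin_eq, standardMeasure, Measure.prod_apply_symm
    ((S.measurableSet_tendsto_prod 0).union (S.measurableSet_tendsto_prod 1)).compl]
  have h : ∀ x : unitInterval, bernoulli p ℕ ((fun ω => (ω, x)) ⁻¹'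
      ({z | Tendsto (fun n => S.fiberIter n z.1 z.2) atTop (𝓝 0)} ∪
        {z | Tendsto (fun n => S.fiberIter n z.1 z.2) atTop (𝓝 1)})ᶜ) = 0 := by
    intro x
    rw [← measureReal_eq_zero_iff, ← S.undecided_real_eq_zero hp hL0 hL1 x]
    congr 1
    ext ω
    simp [ClassS.undecided]
  exact (lintegral_congr h).trans lintegral_zero

/-! ### The separating graph -/

/-- The supremum of the points of the fiber over `ω` whose orbits converge to `0`.  It is defined
for every `ω`, and the set it is taken over always contains `0`. -/
noncomputable def ClassS.separatrix (S : ClassS) (ω : ℤ → Fin 2) : unitInterval :=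
  sSup {x | Tendsto (fun n => S.fiberIter n ω x) atTop (𝓝 0)}

theorem ClassS.tendsto_zero_of_lt_separatrix (S : ClassS) {ω : ℤ → Fin 2} {x : unitInterval}
    (hx : x < S.separatrix ω) : Tendsto (fun n => S.fiberIter n ω x) atTop (𝓝 0) := by
  obtain ⟨y, hy, hxy⟩ := lt_sSup_iff.1 hx
  exact S.tendsto_zero_of_le hxy.le hy

theorem ClassS.separatrix_shift (S : ClassS) (ω : ℤ → Fin 2) :
    S.separatrix (shift ω) = (S.f (ω 0)).toEquiv (S.separatrix ω) := by
  let φ : unitInterval ≃o unitInterval :=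
    (S.strictMono (ω 0)).orderIsoOfSurjective _ (S.f (ω 0)).toEquiv.surjective
  change _ = φ (S.separatrix ω)
  rw [ClassS.separatrix, ClassS.separatrix, φ.map_sSup, ← sSup_image]
  congr 1
  ext y
  obtain ⟨x, rfl⟩ := φ.surjective y
  rw [φ.injective.mem_set_image]
  exact S.tendsto_fiberIter_shift ω x 0

theorem ClassS.measurable_separatrix (S : ClassS) : Measurable S.separatrix := by
  obtain ⟨D, hDc, hD⟩ := TopologicalSpace.exists_countable_dense unitInterval
  refine measurable_of_Ioi fun a => ?_
  have h : S.separatrix ⁻¹' Set.Ioi a =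
      ⋃ q ∈ D ∩ Set.Ioi a, {ω | Tendsto (fun n => S.fiberIter n ω q) atTop (𝓝 0)} := by
    ext ω
    simp only [Set.mem_preimage, Set.mem_Ioi, Set.mem_iUnion, exists_prop]
    constructor
    · intro ha
      obtain ⟨q, hq, haq, hqs⟩ := hD.exists_between ha
      exact ⟨q, ⟨hq, haq⟩, S.tendsto_zero_of_lt_separatrix hqs⟩
    · rintro ⟨q, ⟨-, haq⟩, hq⟩
      exact lt_of_lt_of_le haq (le_sSup hq)
  rw [h]
  exact MeasurableSet.biUnion (hDc.mono Set.inter_subset_left)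
    fun q _ => S.measurableSet_tendsto_fiber 0 q

theorem ClassS.image_graph_separatrix (S : ClassS) :
    S.skew ℤ '' {z | z.2 = S.separatrix z.1} = {z | z.2 = S.separatrix z.1} := by
  ext ⟨ω, x⟩
  constructor
  · rintro ⟨⟨ω', y⟩, hy, h⟩
    change y = S.separatrix ω' at hy
    subst hy
    obtain ⟨rfl, rfl⟩ := Prod.mk.inj h
    exact (S.separatrix_shift ω').symm
  · intro h
    change x = S.separatrix ω at h
    subst h
    have hs : shift (fun n : ℤ => ω (n - 1)) = ω := by
      ext n
      simp [shift]
    refine ⟨(fun n : ℤ => ω (n - 1), S.separatrix fun n : ℤ => ω (n - 1)), rfl, ?_⟩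
    refine Prod.ext hs ?_
    rw [← hs, S.separatrix_shift]
    simp [ClassS.skew, hs]

/-- Almost surely every orbit above the separatrix converges to `1`: between the separatrix and the
given point lies a point of a fixed countable dense set, whose orbit converges to an end point
and, being above the separatrix, not to `0`. -/
theorem ClassS.ae_tendsto_one_of_separatrix_lt (S : ClassS) {p : PMF (Fin 2)} (hp : 0 < p 0)
    (hL0 : S.L p 0 < 0) (hL1 : S.L p 1 < 0) :
    ∀ᵐ ω ∂(bernoulli p ℤ), ∀ x : unitInterval, S.separatrix ω < x →
      Tendsto (fun n => S.fiberIter n ω x) atTop (𝓝 1) := by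
  obtain ⟨D, hDc, hD⟩ := TopologicalSpace.exists_countable_dense unitInterval
  have hdec : ∀ᵐ ω ∂(bernoulli p ℕ), ∀ q ∈ D, ω ∉ S.undecided q :=
    (ae_ball_iff hDc).2 fun q _ => measure_eq_zero_iff_ae_notMem.1
      ((measureReal_eq_zero_iff).1 (S.undecided_real_eq_zero hp hL0 hL1 q))
  filter_upwards [(measurePreserving_bernoulli_int p).quasiMeasurePreserving.ae hdec]
    with ω hω x hx
  obtain ⟨q, hq, hsq, hqx⟩ := hD.exists_between hx
  refine S.tendsto_one_of_le hqx.le (by_contra fun h1 => hω q hq ⟨fun h0 => ?_, ?_⟩)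
  · simp only [← S.fiberIter_int] at h0
    exact hsq.not_ge (le_sSup h0)
  · simpa only [← S.fiberIter_int] using h1

end IntermingledBasins

open IntermingledBasins MeasureTheory Filter Topology in
theorem theorem3p1 (S : ClassS) (p : PMF (Fin 2)) (hp : ∀ i, 0 < p i)
    (hL0 : S.L p 0 < 0) (hL1 : S.L p 1 < 0) :
    (0 < standardMeasure p (basin (S.skew ℕ) (Set.univ ×ˢ {0})) ∧
      0 < standardMeasure p (basin (S.skew ℕ) (Set.univ ×ˢ {1}))) ∧
    (Dense (basin (S.skew ℕ) (Set.univ ×ˢ {0})) ∧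
      Dense (basin (S.skew ℕ) (Set.univ ×ˢ {1}))) ∧
    standardMeasure p
      (basin (S.skew ℕ) (Set.univ ×ˢ {0}) ∪ basin (S.skew ℕ) (Set.univ ×ˢ {1}))ᶜ = 0 ∧
    ∃ ξ : (ℤ → Fin 2) → unitInterval, Measurable ξ ∧
      S.skew ℤ '' {z | z.2 = ξ z.1} = {z | z.2 = ξ z.1} ∧
      ∀ᵐ ω ∂(bernoulli p ℤ), ∀ x : unitInterval,
        (x < ξ ω → Tendsto (fun n : ℕ => S.fiberIter n ω x) atTop (𝓝 0)) ∧
        (ξ ω < x → Tendsto (fun n : ℕ => S.fiberIter n ω x) atTop (𝓝 1)) := by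
  refine ⟨⟨S.standardMeasure_basin_pos p (Or.inl rfl) hL0,
    S.standardMeasure_basin_pos p (Or.inr rfl) hL1⟩,
    ⟨S.dense_basin (Or.inr rfl) 0 fun _ => S.tendsto_iterate_zero,
      S.dense_basin (Or.inl rfl) 1 fun _ => S.tendsto_iterate_one⟩,
    S.standardMeasure_compl_basins (hp 0) hL0 hL1, S.separatrix, S.measurable_separatrix,
    S.image_graph_separatrix, ?_⟩
  filter_upwards [S.ae_tendsto_one_of_separatrix_lt (hp 0) hL0 hL1] with ω hω x
  exact ⟨S.tendsto_zero_of_lt_separatrix, hω x⟩
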